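/- Let $A$ be an infinite set and $F$ an infinite set of functions $A\to\{0,1\}$ (attributes); the pair $U=(A,F)$ is called an infinite binary information system. Let $\mathbb N=\{1,2,\dots\}$. A problem over $U$ of dimension $n\in\mathbb N$ is a tuple $z=(f_1,\dots,f_n)\in F^n$; put $z(a)=(f_1(a),\dots,f_n(a))$ for $a\in A$. A hypothesis over $z$ is an equation system $H=\{f_1(x)=\delta_1,\dots,f_n(x)=\delta_n\}$ with $\delta_i\in\{0,1\}$; it is proper if it has a solution in $A$. A decision tree over $z$ is a finite rooted tree in which each terminal node is labeled with a tuple from $\{0,1\}^n$ and each other (working) node is labeled either with some attribute $f_i$, and then has two outgoing edges labeled $\{f_i(x)=0\}$ and $\{f_i(x)=1\}$, or with a hypothesis $H$, and then has $n+1$ outgoing edges labeled $H,\{f_1(x)=\neg\delta_1\},\dots,\{f_n(x)=\neg\delta_n\}$. The tree solves $z$ relative to $U$ if, for each $a\in A$ and each path from the root to a terminal node all of whose edge labels are satisfied by $a$, the label of that terminal node is $z(a)$. The depth of the tree is the maximum number of working nodes on such root-to-terminal paths. Let $h_U^{(4)}(z)$ be the minimum depth of a decision tree over $z$ that solves $z$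 relative to $U$ and whose working nodes are all labeled with proper hypotheses, and let $h_U^{(5)}(z)$ be the minimum depth of a decision tree over $z$ that solves $z$ relative to $U$ and whose working nodes are labeled with attributes $f_i$ or proper hypotheses. For $i\in\{4,5\}$ and $n\in\mathbb N$ let $h_U^{(i)}(n)=\max\{h_U^{(i)}(z) : z \text{ is a problem over } U \text{ of dimension at most } n\}$. Define classes of infinite binary information systems as follows. $\mathcal D$: a finite set $\{g_1,\dots,g_m\}\subseteq F$ of $m$ distinct attributes is independent if for all $\delta_1,\dots,\delta_m\in\{0,1\}$ the system $\{g_1(x)=\delta_1,\dots,g_m(x)=\delta_m\}$ has a solution in $A$. Then $U\in\mathcal D$ iff the cardinalities of the independent subsets of $F$ are bounded. $\mathcal C$: for $B\subseteq A$, the pair $(B,F)$ is a $0$-information system if every $f\in F$ is constant on $B$; it is a $(k+1)$-information system if it is not an $m$-information system for any $m\in\{0,\dots,k\}$ and, for each $f\in F$, there are $\delta\in\{0,1\}$ and $m\in\{0,\dots,k\}$ such that $(\{a\in B: f(a)=\delta\},F)$ is an $m$-information system. Then $U\in\mathcal C$ iff $(A,F)$ is a $k$-information system for some $k\in\mathbb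 N$. $\mathcal I$: $U\in\mathcal I$ iff there is $r\in\mathbb N$ such that each finite equation system $\{g_1(x)=\delta_1,\dots,g_m(x)=\delta_m\}$ with $g_j\in F$ that has no solution in $A$ contains a subsystem of at most $r$ equations that has no solution in $A$. Theorem. Let $U$ be an infinite binary information system. Then the minima and maxima defining $h_U^{(4)}$ and $h_U^{(5)}$ exist, and the following statements hold (asymptotics are as $n\to\infty$). (a) If $U\in\mathcal C\cap\mathcal I$, then $h_U^{(4)}(n)=O(1)$ and $h_U^{(5)}(n)=O(1)$. (b) If $U\in(\mathcal D\setminus\mathcal C)\cap\mathcal I$, then $h_U^{(4)}(n)=\Theta(\log n)$, $h_U^{(5)}(n)=\Omega\left(\frac{\log n}{\log\log n}\right)$, and $h_U^{(5)}(n)=O(\log n)$. (c) If $U\in\mathcal D\setminus\mathcal I$ and $i\in\{4,5\}$, then $h_U^{(i)}(n)\ge n-1$ for infinitely many $n\in\mathbb N$ and $h_U^{(i)}(n)\le n$ for every $n\in\mathbb N$. (d) If $U\notin\mathcal D$, then $h_U^{(4)}(n)=n$ and $h_U^{(5)}(n)=n$ for every $n\in\mathbb N$. -/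

import Mathlib

open Filter Asymptotics

universe u

/-- A binary information system `U = (A, F)`: a set `A` and a set `F` of functions
(called attributes) from `A` to `{0, 1}`. -/
structure BinarySystem : Type (u + 1) where
  /-- the set of elements -/
  A : Type u
  /-- the set of attributes -/
  F : Set (A → Bool)

/-- Marked finite rooted trees that serve as decision trees over a problem
`z = (f_1, …, f_n)`. The attribute `f_i` is referred to by its index `i`. -/
inductive DecisionTree (n : ℕ) : Type
  /-- a terminal node, labeled with an `n`-tuple -/
  | terminal (t : Fin n → Bool) : DecisionTree n
  /-- a working node labeled with the attribute `f_i`; the edge labeled with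
  `{f_i(x) = b}` enters the root of `next b` -/
  | ask (i : Fin n) (next : Bool → DecisionTree n) : DecisionTree n
  /-- a working node labeled with the hypothesis `H = {f_1(x) = δ_1, …, f_n(x) = δ_n}`;
  the edge labeled with `H` enters the root of `yes`, and the edge labeled with
  `{f_i(x) = ¬ δ_i}` enters the root of `no i` -/
  | guess (δ : Fin n → Bool) (yes : DecisionTree n) (no : Fin n → DecisionTree n) :
      DecisionTree n

namespace DecisionTree

variable {n : ℕ}

/-- The depth: the maximum number of working nodes in a complete path. -/
def depth : DecisionTree n → ℕ
  | terminal _ => 0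
  | ask _ next => (Finset.univ.sup fun b => (next b).depth) + 1
  | guess _ yes no => max yes.depth (Finset.univ.sup fun i => (no i).depth) + 1

/-- `CompletePath Γ S t`: some complete path `ξ` of `Γ` has the equation system `S`
(the union of the systems assigned to its edges) and a terminal node labeled with `t`.
The pair `(i, b)` stands for the equation `f_i(x) = b`. -/
inductive CompletePath :
    DecisionTree n → Set (Fin n × Bool) → (Fin n → Bool) → Prop
  | terminal (t : Fin n → Bool) : CompletePath (terminal t) ∅ t
  | ask (i : Fin n) (next : Bool → DecisionTree n) (b : Bool)
      (S : Set (Fin n × Bool)) (t : Fin n → Bool) (h : CompletePath (next b) S t) :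
      CompletePath (ask i next) ({(i, b)} ∪ S) t
  | guess_yes (δ : Fin n → Bool) (yes : DecisionTree n) (no : Fin n → DecisionTree n)
      (S : Set (Fin n × Bool)) (t : Fin n → Bool) (h : CompletePath yes S t) :
      CompletePath (guess δ yes no) ({e | e.2 = δ e.1} ∪ S) t
  | guess_no (δ : Fin n → Bool) (yes : DecisionTree n) (no : Fin n → DecisionTree n)
      (i : Fin n) (S : Set (Fin n × Bool)) (t : Fin n → Bool)
      (h : CompletePath (no i) S t) :
      CompletePath (guess δ yes no) ({(i, !(δ i))} ∪ S) t

/-- No working node is labeled with an attribute: only hypotheses are used. -/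
def HypothesesOnly : DecisionTree n → Prop
  | terminal _ => True
  | ask _ _ => False
  | guess _ yes no => yes.HypothesesOnly ∧ ∀ i, (no i).HypothesesOnly

/-- Every hypothesis that labels a working node satisfies `P`. -/
def HypothesesSatisfy (P : (Fin n → Bool) → Prop) : DecisionTree n → Prop
  | terminal _ => True
  | ask _ next => ∀ b, (next b).HypothesesSatisfy P
  | guess δ yes no =>
      P δ ∧ yes.HypothesesSatisfy P ∧ ∀ i, (no i).HypothesesSatisfy P

end DecisionTree

namespace BinarySystem

/-- `U` is an infinite binary information system: both `A` and `F` are infinite. -/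
def IsInfinite (U : BinarySystem.{u}) : Prop := Infinite U.A ∧ U.F.Infinite

/-- A problem over `U` of dimension `n` (used for `1 ≤ n` only):
an `n`-tuple of attributes, not necessarily distinct. -/
abbrev Problem (U : BinarySystem.{u}) (n : ℕ) : Type u := Fin n → U.F

/-- The solution `z(a) = (f_1(a), …, f_n(a))`. -/
def value (U : BinarySystem.{u}) {n : ℕ} (z : U.Problem n) (a : U.A) : Fin n → Bool :=
  fun i => (z i).1 a

/-- The hypothesis `{f_1(x) = δ_1, …, f_n(x) = δ_n}` is proper for `U`. -/
def Proper (U : BinarySystem.{u}) {n : ℕ} (z : U.Problem n) (δ : Fin n → Bool) : Prop :=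
  ∃ a : U.A, ∀ i, (z i).1 a = δ i

/-- `Γ` solves the problem `z` relative to `U`: for every element `a` and every complete
path whose equation system has `a` as a solution, the terminal label is `z(a)`. -/
def Solves (U : BinarySystem.{u}) {n : ℕ} (z : U.Problem n) (Γ : DecisionTree n) : Prop :=
  ∀ (a : U.A) (S : Set (Fin n × Bool)) (t : Fin n → Bool),
    Γ.CompletePath S t → (∀ e ∈ S, (z e.1).1 a = e.2) → t = U.value z a

/-- Depths of the decision trees over `z` that solve `z` relative to `U`
and use only proper hypotheses. -/
def depths4 (U : BinarySystem.{u}) {n : ℕ} (z : U.Problem n) : Set ℕ :=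
  {d | ∃ Γ : DecisionTree n, U.Solves z Γ ∧ Γ.HypothesesOnly ∧
    Γ.HypothesesSatisfy (U.Proper z) ∧ Γ.depth = d}

/-- Depths of the decision trees over `z` that solve `z` relative to `U`
and use both attributes and proper hypotheses. -/
def depths5 (U : BinarySystem.{u}) {n : ℕ} (z : U.Problem n) : Set ℕ :=
  {d | ∃ Γ : DecisionTree n, U.Solves z Γ ∧
    Γ.HypothesesSatisfy (U.Proper z) ∧ Γ.depth = d}

/-- `h_U^(4)(z)`, the minimum of `depths4`. -/
noncomputable def h4Problem (U : BinarySystem.{u}) {n : ℕ} (z : U.Problem n) : ℕ :=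
  sInf (U.depths4 z)

/-- `h_U^(5)(z)`, the minimum of `depths5`. -/
noncomputable def h5Problem (U : BinarySystem.{u}) {n : ℕ} (z : U.Problem n) : ℕ :=
  sInf (U.depths5 z)

/-- The values `h_U^(4)(z)` over all problems `z` with `dim z ≤ n`. -/
def values4 (U : BinarySystem.{u}) (n : ℕ) : Set ℕ :=
  {d | ∃ m : ℕ, 1 ≤ m ∧ m ≤ n ∧ ∃ z : U.Problem m, U.h4Problem z = d}

/-- The values `h_U^(5)(z)` over all problems `z` with `dim z ≤ n`. -/
def values5 (U : BinarySystem.{u}) (n : ℕ) : Set ℕ :=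
  {d | ∃ m : ℕ, 1 ≤ m ∧ m ≤ n ∧ ∃ z : U.Problem m, U.h5Problem z = d}

/-- `h_U^(4)(n)`, the maximum of `values4`. -/
noncomputable def h4 (U : BinarySystem.{u}) (n : ℕ) : ℕ := sSup (U.values4 n)

/-- `h_U^(5)(n)`, the maximum of `values5`. -/
noncomputable def h5 (U : BinarySystem.{u}) (n : ℕ) : ℕ := sSup (U.values5 n)

/-- `G` is an independent (finite) subset of `F`; the empty set is independent. -/
def Independent (U : BinarySystem.{u}) (G : Finset (U.A → Bool)) : Prop :=
  (G : Set (U.A → Bool)) ⊆ U.F ∧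
    (G.Nonempty → ∀ δ : (U.A → Bool) → Bool, ∃ a : U.A, ∀ f ∈ G, f a = δ f)

/-- The independence dimension `I(U)`, possibly infinite. -/
noncomputable def iDim (U : BinarySystem.{u}) : ℕ∞ :=
  ⨆ (G : Finset (U.A → Bool)) (_ : U.Independent G), (G.card : ℕ∞)

/-- `U ∈ D`: infinite systems of finite independence dimension. -/
def MemD (U : BinarySystem.{u}) : Prop := U.IsInfinite ∧ U.iDim ≠ ⊤

/-- `U.IsInfoOn k B`: the binary information system `(B, F)`, with the attributes of `U`
restricted to `B ⊆ A`, is a `k`-information system. -/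
def IsInfoOn (U : BinarySystem.{u}) : ℕ → Set U.A → Prop
  | 0, B => ∀ f ∈ U.F, ∀ a ∈ B, ∀ b ∈ B, f a = f b
  | k + 1, B => (∀ m : Fin (k + 1), ¬ U.IsInfoOn m.1 B) ∧
      ∀ f ∈ U.F, ∃ (δ : Bool) (m : Fin (k + 1)), U.IsInfoOn m.1 {a | a ∈ B ∧ f a = δ}
termination_by k => k
decreasing_by all_goals exact m.2

/-- `U ∈ C`: infinite systems that are `k`-information systems for some `k ≥ 1`. -/
def MemC (U : BinarySystem.{u}) : Prop :=
  U.IsInfinite ∧ ∃ k : ℕ, 1 ≤ k ∧ U.IsInfoOn k Set.univ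

/-- A finite system of equations over `U`; the pair `(f, δ)` stands for `f(x) = δ`. -/
abbrev EqSystem (U : BinarySystem.{u}) : Type u := Finset (U.F × Bool)

/-- The equation system has a solution on `A`. -/
def Consistent (U : BinarySystem.{u}) (S : U.EqSystem) : Prop :=
  ∃ a : U.A, ∀ e ∈ S, e.1.1 a = e.2

/-- `U` is `r`-i-reduced: every inconsistent equation system over `U` has an inconsistent
subsystem with at most `r` equations. -/
def IReduced (U : BinarySystem.{u}) (r : ℕ) : Prop :=
  ∀ S : U.EqSystem, ¬ U.Consistent S →
    ∃ T : U.EqSystem, T ⊆ S ∧ ¬ U.Consistent T ∧ T.card ≤ r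

/-- `U ∈ I`: infinite systems that are `r`-i-reduced for some `r ≥ 1`. -/
def MemI (U : BinarySystem.{u}) : Prop :=
  U.IsInfinite ∧ ∃ r : ℕ, 1 ≤ r ∧ U.IReduced r

end BinarySystem

/-! Everything about a problem `z` depends only on the set `R` of its tuples `z(a)`. Since `h5 ≤
h4`, upper bounds are proved for `h4` and lower bounds for `h5`, except that the `log n` lower bound
for `h4` has its own argument. The bound `n` always holds: guess a remaining tuple, and each
counterexample settles one more coordinate (`card_of_eqOn`). Lower bounds come from adversaries.
Outside D, `R` can be a full cube, and one answer fixes only one coordinate. Outside I, there are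
arbitrarily large minimal inconsistent systems; their right-hand side `y` is improper, while all
tuples that differ from `y` in one place are proper, and an adversary answering according to `y`
loses at most one of them per query. Outside C, splitting along attributes both of whose halves have
large rank gives a complete binary tree of depth `d` with fewer than `2 ^ d` attributes. Against
hypotheses alone the adversary descends one level per query, so depth `d` is needed. With attributes
allowed, one counts the `2 ^ d` leaves: a query splits them, up to one leaf, into at most `d` parts
that matter, whence `2 ^ d ≤ (d + 1) ^ h5`. Membership in I is a Helly property of `R`. With finite
rank it allows induction on the rank: guess the values opposite to the rank-lowering ones; if this
is improper, at most `r` lower-rank pieces cover everything. With D, Sauer–Shelah bounds `R`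
polynomially, and the Helly property yields a proper hypothesis each of whose counterexamples leaves
at most the fraction `1 - 1 / r`, so `O(log n)` queries suffice. -/

namespace DecisionTree

variable {n : ℕ}

/-! ### Decision trees acting on sets of tuples -/

/-- `Γ` determines every tuple of `V`: each complete path compatible with `x ∈ V` ends in a
terminal node labeled with `x`. -/
def SolvesOn (Γ : DecisionTree n) (V : Set (Fin n → Bool)) : Prop :=
  ∀ x ∈ V, ∀ (S : Set (Fin n × Bool)) (t : Fin n → Bool),
    Γ.CompletePath S t → (∀ e ∈ S, x e.1 = e.2) → t = x

theorem SolvesOn.mono {Γ : DecisionTree n} {V W : Set (Fin n → Bool)} (h : Γ.SolvesOn W)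
    (hVW : V ⊆ W) : Γ.SolvesOn V :=
  fun x hx => h x (hVW hx)

theorem solvesOn_terminal {t : Fin n → Bool} {V : Set (Fin n → Bool)} :
    (terminal t).SolvesOn V ↔ ∀ x ∈ V, t = x := by
  constructor
  · intro h x hx
    exact h x hx ∅ t (.terminal t) (by simp)
  · intro h x hx S t' hp _
    cases hp
    exact h x hx

theorem solvesOn_ask {i : Fin n} {next : Bool → DecisionTree n} {V : Set (Fin n → Bool)} :
    (ask i next).SolvesOn V ↔ ∀ b, (next b).SolvesOn {x ∈ V | x i = b} := by
  constructor
  · rintro h b x ⟨hx, hxi⟩ S t hp hS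
    refine h x hx _ t (.ask i next b S t hp) ?_
    rintro e (he | he)
    · obtain rfl : e = (i, b) := he
      exact hxi
    · exact hS e he
  · intro h x hx S t hp hS
    cases hp with
    | ask _ _ b S t hp =>
      exact h b x ⟨hx, hS (i, b) (by simp)⟩ S t hp fun e he => hS e (Or.inr he)

/-- The counterexample branches may overlap: a tuple follows `no i` for every `i` at which it
differs from `δ`, and each of these branches must answer correctly. -/
theorem solvesOn_guess {δ : Fin n → Bool} {yes : DecisionTree n} {no : Fin n → DecisionTree n}
    {V : Set (Fin n → Bool)} :
    (guess δ yes no).SolvesOn V ↔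
      yes.SolvesOn {x ∈ V | x = δ} ∧ ∀ i, (no i).SolvesOn {x ∈ V | x i = !δ i} := by
  constructor
  · intro h
    constructor
    · rintro x ⟨hx, rfl⟩ S t hp hS
      refine h x hx _ t (.guess_yes x yes no S t hp) ?_
      rintro e (he | he)
      · exact Eq.symm he
      · exact hS e he
    · rintro i x ⟨hx, hxi⟩ S t hp hS
      refine h x hx _ t (.guess_no δ yes no i S t hp) ?_
      rintro e (he | he)
      · obtain rfl : e = (i, !δ i) := he
        exact hxi
      · exact hS e he
  · rintro ⟨hy, hn⟩ x hx S t hp hS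
    cases hp with
    | guess_yes _ _ _ S t hp =>
      exact hy x ⟨hx, funext fun i => hS (i, δ i) (Or.inl rfl)⟩ S t hp
        fun e he => hS e (Or.inr he)
    | guess_no _ _ _ i S t hp =>
      exact hn i x ⟨hx, hS (i, !δ i) (by simp)⟩ S t hp fun e he => hS e (Or.inr he)

theorem depth_next_lt (i : Fin n) (next : Bool → DecisionTree n) (b : Bool) :
    (next b).depth + 1 ≤ (ask i next).depth := by
  simp only [depth]
  exact Nat.succ_le_succ (Finset.le_sup (f := fun b => (next b).depth) (Finset.mem_univ b))

theorem depth_no_lt (δ : Fin n → Bool) (yes : DecisionTree n) (no : Fin n → DecisionTree n)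
    (i : Fin n) : (no i).depth + 1 ≤ (guess δ yes no).depth := by
  simp only [depth]
  exact Nat.succ_le_succ (le_max_of_le_right
    (Finset.le_sup (f := fun i => (no i).depth) (Finset.mem_univ i)))

end DecisionTree

/-! ### Strategies using hypotheses only -/

/-- The tuples of `V` can be identified by a strategy that asks at most `d` hypotheses, all of
them from `R`. -/
inductive HypothesisBound {n : ℕ} (R : Set (Fin n → Bool)) : Set (Fin n → Bool) → ℕ → Prop
  | base {V : Set (Fin n → Bool)} (d : ℕ) (h : V.Subsingleton) : HypothesisBound R V d
  | step {V : Set (Fin n → Bool)} {d : ℕ} (δ : Fin n → Bool) (hδ : δ ∈ R)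
      (h : ∀ i, HypothesisBound R {x ∈ V | x i ≠ δ i} d) : HypothesisBound R V (d + 1)

namespace HypothesisBound

variable {n : ℕ} {R : Set (Fin n → Bool)}

theorem mono {V W : Set (Fin n → Bool)} {d e : ℕ} (h : HypothesisBound R W d) (hVW : V ⊆ W)
    (hde : d ≤ e) : HypothesisBound R V e := by
  induction h generalizing V e with
  | base d h => exact .base e (h.anti hVW)
  | step δ hδ _ ih =>
    obtain ⟨e, rfl⟩ : ∃ e', e = e' + 1 := ⟨e - 1, by omega⟩
    exact .step δ hδ fun i => ih i (fun x hx => ⟨hVW hx.1, hx.2⟩) (by omega)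

/-- A confirmed hypothesis determines the tuple, so only counterexample branches need a subtree. -/
theorem exists_tree {V : Set (Fin n → Bool)} {d : ℕ} (h : HypothesisBound R V d) :
    ∃ Γ : DecisionTree n, Γ.SolvesOn V ∧ Γ.HypothesesOnly ∧ Γ.HypothesesSatisfy (· ∈ R) ∧
      Γ.depth ≤ d := by
  induction h with
  | @base V d h =>
    rcases V.eq_empty_or_nonempty with rfl | ⟨x, hx⟩
    · exact ⟨.terminal fun _ => false, by simp [DecisionTree.solvesOn_terminal], trivial, trivial,
        Nat.zero_le _⟩
    · exact ⟨.terminal x, DecisionTree.solvesOn_terminal.2 fun y hy => h hx hy, trivial, trivial,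
        Nat.zero_le _⟩
  | @step V d δ hδ _ ih =>
    choose no h1 h2 h3 h4 using ih
    refine ⟨.guess δ (.terminal δ) no, ?_, ⟨trivial, h2⟩, ⟨hδ, trivial, h3⟩, ?_⟩
    · refine DecisionTree.solvesOn_guess.2 ⟨?_, fun i => (h1 i).mono ?_⟩
      · exact DecisionTree.solvesOn_terminal.2 fun x hx => hx.2.symm
      · rintro x ⟨hx, hxi⟩
        exact ⟨hx, by simp [hxi]⟩
    · simp only [DecisionTree.depth]
      simpa using h4

/-- Run the strategy for `V`; where it would stop with one candidate in `V`, guess that candidate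
(this is why `V ⊆ R`). Any counterexample leaves only `W`. The extra guess is the `+ 1`. -/
theorem union {V W : Set (Fin n → Bool)} {d e : ℕ} (hV : HypothesisBound R V d) (hVR : V ⊆ R)
    (hW : HypothesisBound R W e) : HypothesisBound R (V ∪ W) (d + e + 1) := by
  induction hV generalizing W with
  | @base V d h =>
    rcases V.eq_empty_or_nonempty with rfl | ⟨y, hy⟩
    · exact hW.mono (by simp) (by omega)
    · refine .step y (hVR hy) fun i => hW.mono ?_ (by omega)
      rintro x ⟨hx | hx, hxi⟩
      · exact absurd (congrFun (h hx hy) i) hxi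
      · exact hx
  | @step V d δ hδ _ ih =>
    rw [show d + 1 + e + 1 = (d + e + 1) + 1 by omega]
    refine .step δ hδ fun i => ?_
    refine (ih i (fun x hx => hVR hx.1) hW).mono ?_ le_rfl
    rintro x ⟨hx | hx, hxi⟩
    · exact Or.inl ⟨hx, hxi⟩
    · exact Or.inr hx

theorem biUnion {ι : Type*} (T : Finset ι) (V : ι → Set (Fin n → Bool)) {d : ℕ}
    (hVR : ∀ i ∈ T, V i ⊆ R) (h : ∀ i ∈ T, HypothesisBound R (V i) d) :
    HypothesisBound R (⋃ i ∈ T, V i) (T.card * (d + 1)) := by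
  classical
  induction T using Finset.induction_on with
  | empty => exact .base _ (by simp)
  | insert i T hi ih =>
    rw [Finset.set_biUnion_insert, Finset.card_insert_of_notMem hi]
    refine ((h i (by simp)).union (hVR i (by simp))
      (ih (fun j hj => hVR j (by simp [hj])) fun j hj => h j (by simp [hj]))).mono le_rfl ?_
    rw [Nat.succ_mul]
    omega

/-- Guess any member of `V`. A counterexample at `i ∈ I` settles coordinate `i`, and none is
possible outside `I`. -/
theorem card_of_eqOn (V : Set (Fin n → Bool)) (hVR : V ⊆ R) (I : Finset (Fin n))
    (h : ∀ x ∈ V, ∀ y ∈ V, ∀ i ∉ I, x i = y i) : HypothesisBound R V I.card := by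
  induction hm : I.card generalizing I V with
  | zero =>
    obtain rfl := Finset.card_eq_zero.1 hm
    exact .base _ fun x hx y hy => funext fun i => h x hx y hy i (by simp)
  | succ m ih =>
    rcases V.eq_empty_or_nonempty with rfl | ⟨δ, hδ⟩
    · exact .base _ Set.subsingleton_empty
    refine .step δ (hVR hδ) fun i => ?_
    by_cases hi : i ∈ I
    · refine ih _ (fun x hx => hVR hx.1) (I.erase i) ?_ (by simp [hi, hm])
      rintro x ⟨hx, hxi⟩ y ⟨hy, hyi⟩ j hj
      by_cases hji : j = i
      · subst hji
        exact (Bool.eq_not.2 hxi).trans (Bool.eq_not.2 hyi).symm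
      · exact h x hx y hy j (by simpa [hji] using hj)
    · refine .base _ ?_
      rintro x ⟨hx, hxi⟩
      exact absurd (h x hx δ hδ i hi) hxi

end HypothesisBound

/-! ### Helly property and balanced hypotheses -/

/-- Every system of equations `x i = m i` without a solution in `R` has a subsystem of at most `r`
equations without a solution in `R`. -/
def HellyBound {n : ℕ} (R : Set (Fin n → Bool)) (r : ℕ) : Prop :=
  ∀ (J : Finset (Fin n)) (m : Fin n → Bool), (∀ x ∈ R, ∃ i ∈ J, x i ≠ m i) →
    ∃ T ⊆ J, T.card ≤ r ∧ ∀ x ∈ R, ∃ i ∈ T, x i ≠ m i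

/-- Some tuple of `R` is such that each counterexample to it leaves at most the fraction
`1 - 1 / r` of `V`. -/
theorem HellyBound.exists_balanced {n r : ℕ} {R : Set (Fin n → Bool)} (hR : HellyBound R r)
    (hr : 2 ≤ r) (V : Finset (Fin n → Bool)) (hVR : (V : Set (Fin n → Bool)) ⊆ R)
    (hV : V.Nonempty) :
    ∃ δ ∈ R, ∀ i, r * (V.filter fun x => x i ≠ δ i).card ≤ (r - 1) * V.card := by
  classical
  -- `J` collects the lopsided coordinates, where one value `m i` is missed by less than `1 / r` of
  -- `V`.
  let J : Finset (Fin n) :=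
    Finset.univ.filter fun i => ∃ b, r * (V.filter fun x => x i ≠ b).card < V.card
  have hJ : ∀ i, ∃ b, i ∈ J → r * (V.filter fun x => x i ≠ b).card < V.card := by
    intro i
    by_cases hi : i ∈ J
    · obtain ⟨b, hb⟩ := (Finset.mem_filter.1 hi).2
      exact ⟨b, fun _ => hb⟩
    · exact ⟨false, fun h => absurd h hi⟩
  choose m hm using hJ
  have hex : ∃ δ ∈ R, ∀ i ∈ J, δ i = m i := by
    -- Otherwise at most `r` coordinates refute the majority values, and their minority parts, each
    -- smaller than `V.card / r`, would cover `V`.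
    by_contra hcon
    push Not at hcon
    obtain ⟨T, hTJ, hTr, hT⟩ := hR J m hcon
    have hcover : V ⊆ T.biUnion fun i => V.filter fun x => x i ≠ m i := by
      intro x hx
      obtain ⟨i, hi, hxi⟩ := hT x (hVR hx)
      exact Finset.mem_biUnion.2 ⟨i, hi, Finset.mem_filter.2 ⟨hx, hxi⟩⟩
    have hTne : T.Nonempty := by
      obtain ⟨x, hx⟩ := hV
      obtain ⟨i, hi, _⟩ := hT x (hVR hx)
      exact ⟨i, hi⟩
    have h1 : V.card ≤ ∑ i ∈ T, (V.filter fun x => x i ≠ m i).card :=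
      (Finset.card_le_card hcover).trans Finset.card_biUnion_le
    have h2 : ∑ i ∈ T, r * (V.filter fun x => x i ≠ m i).card < ∑ _i ∈ T, V.card :=
      Finset.sum_lt_sum_of_nonempty hTne fun i hi => hm i (hTJ hi)
    rw [← Finset.mul_sum, Finset.sum_const, smul_eq_mul] at h2
    have h3 := Nat.mul_le_mul_right V.card hTr
    have h4 := Nat.mul_le_mul_left r h1
    omega
  obtain ⟨δ, hδR, hδ⟩ := hex
  refine ⟨δ, hδR, fun i => ?_⟩
  obtain ⟨s, rfl⟩ : ∃ s, r = s + 2 := ⟨r - 2, by omega⟩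
  rw [show s + 2 - 1 = s + 1 by omega]
  by_cases hi : i ∈ J
  · have := hm i hi
    rw [← hδ i hi] at this
    nlinarith
  -- Off `J` both values have a share of at least `1 / r`, so any choice of `δ i` is balanced.
  · have h1 : V.card ≤ (s + 2) * (V.filter fun x => x i ≠ !δ i).card := by
      by_contra hlt
      exact hi (Finset.mem_filter.2 ⟨Finset.mem_univ i, !δ i, not_le.1 hlt⟩)
    have h2 := Finset.card_filter_add_card_filter_not (s := V) (fun x => x i ≠ δ i)
    have h3 : (V.filter fun x => ¬ x i ≠ δ i) = V.filter fun x => x i ≠ !δ i := by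
      refine Finset.filter_congr fun x _ => ?_
      cases x i <;> cases δ i <;> simp
    rw [h3] at h2
    nlinarith

theorem HellyBound.hypothesisBound {n r : ℕ} {R : Set (Fin n → Bool)} (hR : HellyBound R r)
    (hr : 2 ≤ r) (d : ℕ) (V : Finset (Fin n → Bool)) (hVR : (V : Set (Fin n → Bool)) ⊆ R)
    (hcard : V.card * (r - 1) ^ d ≤ r ^ d) : HypothesisBound R (V : Set (Fin n → Bool)) d := by
  classical
  induction d generalizing V with
  | zero =>
    refine .base _ ?_
    have : V.card ≤ 1 := by simpa using hcard
    exact Finset.card_le_one_iff_subsingleton.1 this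
  | succ d ih =>
    rcases V.eq_empty_or_nonempty with rfl | hV
    · exact .base _ (by simp)
    obtain ⟨δ, hδ, h⟩ := hR.exists_balanced hr V hVR hV
    refine .step δ hδ fun i => ?_
    have := ih (V.filter fun x => x i ≠ δ i) (fun x hx => hVR (Finset.mem_filter.1 hx).1) ?_
    · simpa using this
    · refine Nat.le_of_mul_le_mul_left ?_ (by omega : 0 < r)
      calc r * ((V.filter fun x => x i ≠ δ i).card * (r - 1) ^ d)
          = (r * (V.filter fun x => x i ≠ δ i).card) * (r - 1) ^ d := by ring
        _ ≤ ((r - 1) * V.card) * (r - 1) ^ d := Nat.mul_le_mul_right _ (h i)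
        _ = V.card * (r - 1) ^ (d + 1) := by ring
        _ ≤ r ^ (d + 1) := hcard
        _ = r * r ^ d := by ring

/-! ### Adversaries on cubes and stars -/

namespace DecisionTree

variable {n : ℕ}

/-- A tree that determines all tuples of a subcube has depth at least the dimension of it. -/
theorem SolvesOn.card_le_depth_of_cube {Γ : DecisionTree n} {V : Set (Fin n → Bool)}
    (hΓ : Γ.SolvesOn V) (I : Finset (Fin n)) (y : Fin n → Bool)
    (hV : ∀ x : Fin n → Bool, (∀ i ∉ I, x i = y i) → x ∈ V) : I.card ≤ Γ.depth := by
  classical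
  induction Γ generalizing V I y with
  | terminal t =>
    rw [solvesOn_terminal] at hΓ
    by_contra hlt
    obtain ⟨i, hi⟩ := Finset.card_pos.1 (lt_of_le_of_lt (Nat.zero_le _) (not_le.1 hlt))
    have h1 := hΓ (Function.update y i true) (hV _ (by grind))
    have h2 := hΓ (Function.update y i false) (hV _ (by grind))
    simpa using congrFun (h1.symm.trans h2) i
  | ask i next ih =>
    have h := ih (y i) (solvesOn_ask.1 hΓ (y i)) (I.erase i) y
      fun x hx => ⟨hV x fun j hj => hx j (by simp [hj]), hx i (by simp)⟩
    have := depth_next_lt i next (y i)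
    have := Finset.pred_card_le_card_erase (s := I) (a := i)
    omega
  | guess δ yes no _ ih =>
    rcases I.eq_empty_or_nonempty with rfl | ⟨i, hi⟩
    · simp
    have h := ih i ((solvesOn_guess.1 hΓ).2 i) (I.erase i) (Function.update y i (!δ i)) (by
      intro x hx
      refine ⟨hV x fun j hj => ?_, by simpa using hx i (by simp)⟩
      have hji : j ≠ i := fun h => hj (h ▸ hi)
      simpa [hji] using hx j (by simp [hj]))
    have := depth_no_lt δ yes no i
    have := Finset.card_erase_of_mem hi
    omega

/-- A tree whose hypotheses are all different from `y` and that determines `m` of the tuples which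
differ from `y` in one place has depth at least `m - 1`. -/
theorem SolvesOn.card_le_depth_of_star {Γ : DecisionTree n} {V : Set (Fin n → Bool)}
    (hΓ : Γ.SolvesOn V) {P : (Fin n → Bool) → Prop} (hP : Γ.HypothesesSatisfy P)
    {y : Fin n → Bool} (hy : ¬ P y) (I : Finset (Fin n))
    (hV : ∀ i ∈ I, Function.update y i (!y i) ∈ V) : I.card ≤ Γ.depth + 1 := by
  classical
  -- The answer `x i = y i` excludes only the neighbour of `y` flipped at `i`.
  have restrict : ∀ (V : Set (Fin n → Bool)) (I : Finset (Fin n)) (i : Fin n),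
      (∀ j ∈ I, Function.update y j (!y j) ∈ V) →
      ∀ j ∈ I.erase i, Function.update y j (!y j) ∈ {x ∈ V | x i = y i} := by
    intro V I i hV j hj
    refine ⟨hV j (Finset.mem_of_mem_erase hj), ?_⟩
    simp [(Finset.ne_of_mem_erase hj).symm]
  induction Γ generalizing V I with
  | terminal t =>
    rw [solvesOn_terminal] at hΓ
    simp only [depth, zero_add]
    refine Finset.card_le_one.2 fun i hi j hj => ?_
    by_contra hij
    simpa [hij] using congrFun ((hΓ _ (hV i hi)).symm.trans (hΓ _ (hV j hj))) i
  | ask i next ih =>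
    have h := ih (y i) (solvesOn_ask.1 hΓ (y i)) (hP (y i)) (I.erase i) (restrict V I i hV)
    have := depth_next_lt i next (y i)
    have := Finset.pred_card_le_card_erase (s := I) (a := i)
    omega
  | guess δ yes no _ ih =>
    -- The guess is not `y`, so some counterexample to it agrees with `y`.
    obtain ⟨i, hi⟩ : ∃ i, δ i ≠ y i := by
      by_contra hcon
      push Not at hcon
      exact hy (funext hcon ▸ hP.1)
    have hyi : (!δ i) = y i := (Bool.eq_not.2 hi.symm).symm
    have h := ih i ((solvesOn_guess.1 hΓ).2 i) (hP.2.2 i) (I.erase i)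
      (by rw [hyi]; exact restrict V I i hV)
    have := depth_no_lt δ yes no i
    have := Finset.pred_card_le_card_erase (s := I) (a := i)
    omega

end DecisionTree

/-! ### Complete binary trees and the lower bounds they give -/

/-- A complete binary tree of depth `d`, with inner nodes labeled by functions of `P`, is realized
by elements of `B`: each branch is followed by some element. -/
def Littlestone {α : Type*} (P : Set (α → Bool)) : ℕ → Set α → Prop
  | 0, B => B.Nonempty
  | d + 1, B => ∃ f ∈ P, ∀ b, Littlestone P d {a ∈ B | f a = b}

namespace Littlestone

theorem mono {α : Type*} {P Q : Set (α → Bool)} (hPQ : P ⊆ Q) {d : ℕ} {B : Set α}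
    (h : Littlestone P d B) : Littlestone Q d B := by
  induction d generalizing B with
  | zero => exact h
  | succ d ih =>
    obtain ⟨f, hf, h⟩ := h
    exact ⟨f, hPQ hf, fun b => ih (h b)⟩

theorem nonempty {α : Type*} {P : Set (α → Bool)} {d : ℕ} {B : Set α}
    (h : Littlestone P d B) : B.Nonempty := by
  induction d generalizing B with
  | zero => exact h
  | succ d ih =>
    obtain ⟨f, hf, h⟩ := h
    exact (ih (h true)).mono fun a ha => ha.1

/-- Every assignment `δ` is refuted by at most `d` functions on all but at most one of `2 ^ d`
suitable elements. -/
theorem exists_finset {α : Type*} {P : Set (α → Bool)} {d : ℕ} {B : Set α}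
    (h : Littlestone P d B) :
    ∃ L : Finset α, (L : Set α) ⊆ B ∧ L.card = 2 ^ d ∧
      ∀ δ : (α → Bool) → Bool, ∃ J : Finset (α → Bool), (J : Set (α → Bool)) ⊆ P ∧ J.card ≤ d ∧
        ∃ a₀, ∀ a ∈ L, a ≠ a₀ → ∃ f ∈ J, f a ≠ δ f := by
  classical
  induction d generalizing B with
  | zero =>
    obtain ⟨a, ha⟩ := h
    refine ⟨{a}, by simpa using ha, by simp, fun δ => ⟨∅, by simp, by simp, a, ?_⟩⟩
    intro a' ha' hne
    exact absurd (Finset.mem_singleton.1 ha') hne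
  | succ d ih =>
    obtain ⟨f, hf, h⟩ := h
    choose L hLB hL hLJ using fun b => ih (h b)
    have hdisj : Disjoint (L true) (L false) := by
      refine Finset.disjoint_left.2 fun a h1 h2 => ?_
      have e1 : f a = true := (hLB true h1).2
      have e2 : f a = false := (hLB false h2).2
      simp [e1] at e2
    refine ⟨L true ∪ L false, ?_, ?_, fun δ => ?_⟩
    · intro a ha
      rcases Finset.mem_union.1 ha with ha | ha
      · exact (hLB _ ha).1
      · exact (hLB _ ha).1
    · rw [Finset.card_union_of_disjoint hdisj, hL, hL, pow_succ]
      ring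
    -- Descend into the half agreeing with `δ`; `f` itself refutes `δ` on the other half. The
    -- exception `a₀` is the leaf at the end of the branch along `δ`.
    · obtain ⟨J, hJP, hJ, a₀, ha₀⟩ := hLJ (δ f) δ
      refine ⟨insert f J, ?_, (Finset.card_insert_le _ _).trans (by omega), a₀, ?_⟩
      · rw [Finset.coe_insert]
        exact Set.insert_subset hf hJP
      · intro a ha hne
        obtain ⟨b, hb⟩ : ∃ b, a ∈ L b := by
          rcases Finset.mem_union.1 ha with ha | ha
          exacts [⟨_, ha⟩, ⟨_, ha⟩]
        by_cases hbf : b = δ f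
        · subst hbf
          obtain ⟨g, hg, hga⟩ := ha₀ a hb hne
          exact ⟨g, Finset.mem_insert_of_mem hg, hga⟩
        · have : f a = b := (hLB b hb).2
          exact ⟨f, Finset.mem_insert_self _ _, by rwa [this]⟩

end Littlestone

namespace DecisionTree

variable {n : ℕ}

/-- The adversary gives the counterexample at the root label `i` of the binary tree, so the subtree
on the side `!δ i` survives. -/
theorem SolvesOn.littlestone_le_depth {Γ : DecisionTree n} {V : Set (Fin n → Bool)}
    (hΓ : Γ.SolvesOn V) (hO : Γ.HypothesesOnly) {d : ℕ}
    (h : Littlestone (Set.range fun (i : Fin n) (x : Fin n → Bool) => x i) d V) :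
    d ≤ Γ.depth := by
  induction Γ generalizing V d with
  | terminal t =>
    rw [solvesOn_terminal] at hΓ
    cases d with
    | zero => exact le_rfl
    | succ d =>
      obtain ⟨f, -, h⟩ := h
      obtain ⟨x, hx, hx'⟩ := (h true).nonempty
      obtain ⟨y, hy, hy'⟩ := (h false).nonempty
      rw [← hΓ x hx, hΓ y hy, hy'] at hx'
      cases hx'
  | ask i next ih => exact hO.elim
  | guess δ yes no _ ih =>
    cases d with
    | zero => exact Nat.zero_le _
    | succ d =>
      obtain ⟨_, ⟨i, rfl⟩, h⟩ := h
      have := ih i ((solvesOn_guess.1 hΓ).2 i) (hO.2 i) (h (!δ i))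
      have := depth_no_lt δ yes no i
      omega

/-- The refutation property passes to subsets of `L`. With `q` levels left, a guess gives `1 + d *
(d + 1) ^ q` at most and an attribute `2 * (d + 1) ^ q`; both are at most `(d + 1) ^ (q + 1)`, the
latter because `1 ≤ d`. -/
theorem SolvesOn.card_le_pow_depth {Γ : DecisionTree n} {L : Finset (Fin n → Bool)}
    (hΓ : Γ.SolvesOn L) {d : ℕ} (hd : 1 ≤ d)
    (hL : ∀ δ : Fin n → Bool, ∃ J : Finset (Fin n), J.card ≤ d ∧
      ∃ x₀, ∀ x ∈ L, x ≠ x₀ → ∃ i ∈ J, x i ≠ δ i) : L.card ≤ (d + 1) ^ Γ.depth := by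
  classical
  induction Γ generalizing L with
  | terminal t =>
    rw [solvesOn_terminal] at hΓ
    simp only [depth, pow_zero]
    exact Finset.card_le_one.2 fun x hx y hy => (hΓ x hx).symm.trans (hΓ y hy)
  | ask i next ih =>
    have hb : ∀ b, (L.filter fun x => x i = b).card ≤ (d + 1) ^ ((ask i next).depth - 1) := by
      intro b
      refine (ih b (L := L.filter fun x => x i = b) ?_ ?_).trans
        (Nat.pow_le_pow_right (by omega) (by have := depth_next_lt i next b; omega))
      · simpa using solvesOn_ask.1 hΓ b
      · intro δ
        obtain ⟨J, hJ, x₀, h⟩ := hL δ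
        exact ⟨J, hJ, x₀, fun x hx => h x (Finset.mem_filter.1 hx).1⟩
    have h1 := Finset.card_filter_add_card_filter_not (s := L) (fun x => x i = true)
    have h2 : (L.filter fun x => ¬ x i = true) = L.filter fun x => x i = false := by simp
    rw [h2] at h1
    have h3 := hb true
    have h4 := hb false
    obtain ⟨q, hq⟩ : ∃ q, (ask i next).depth = q + 1 :=
      ⟨_, (Nat.sub_add_cancel (le_trans (by omega) (depth_next_lt i next true))).symm⟩
    rw [hq, Nat.add_sub_cancel] at h3 h4
    rw [hq, pow_succ]
    nlinarith
  | guess δ yes no _ ih =>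
    obtain ⟨J, hJ, x₀, h⟩ := hL δ
    have hb : ∀ i, (L.filter fun x => x i ≠ δ i).card ≤
        (d + 1) ^ ((guess δ yes no).depth - 1) := by
      intro i
      refine (ih i (L := L.filter fun x => x i ≠ δ i) ?_ ?_).trans
        (Nat.pow_le_pow_right (by omega) (by have := depth_no_lt δ yes no i; omega))
      · refine ((solvesOn_guess.1 hΓ).2 i).mono ?_
        intro x hx
        obtain ⟨h1, h2⟩ := Finset.mem_filter.1 hx
        exact ⟨h1, Bool.eq_not.2 h2⟩
      · intro δ
        obtain ⟨J, hJ, x₀, h⟩ := hL δ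
        exact ⟨J, hJ, x₀, fun x hx => h x (Finset.mem_filter.1 hx).1⟩
    obtain ⟨q, hq⟩ : ∃ q, (guess δ yes no).depth = q + 1 := ⟨_, rfl⟩
    simp only [hq, Nat.add_sub_cancel] at hb
    have hcover : L ⊆ insert x₀ (J.biUnion fun i => L.filter fun x => x i ≠ δ i) := by
      intro x hx
      by_cases hx0 : x = x₀
      · simp [hx0]
      · obtain ⟨i, hi, hxi⟩ := h x hx hx0
        exact Finset.mem_insert_of_mem
          (Finset.mem_biUnion.2 ⟨i, hi, Finset.mem_filter.2 ⟨hx, hxi⟩⟩)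
    have h1 := (Finset.card_le_card hcover).trans (Finset.card_insert_le _ _)
    have h2 : (J.biUnion fun i => L.filter fun x => x i ≠ δ i).card ≤ J.card * (d + 1) ^ q :=
      Finset.card_biUnion_le_card_mul _ _ _ fun i _ => hb i
    have h3 := Nat.mul_le_mul_right ((d + 1) ^ q) hJ
    have h4 : 1 ≤ (d + 1) ^ q := Nat.one_le_pow _ _ (by omega)
    rw [hq, pow_succ]
    nlinarith

end DecisionTree

/-- The partial sums of a row of Pascal's triangle are polynomially bounded. -/
theorem sum_choose_le_succ_pow (n D : ℕ) :
    ∑ k ∈ Finset.range (D + 1), n.choose k ≤ (n + 1) ^ D := by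
  -- Compare termwise with the binomial expansion of `(n + 1) ^ D`, using `n.choose k ≤ n ^ k`.
  rw [add_pow]
  refine Finset.sum_le_sum fun k hk => ?_
  have h1 : 1 ≤ D.choose k := Nat.choose_pos (by simpa [Nat.lt_succ_iff] using hk)
  simpa using (Nat.choose_le_pow n k).trans (Nat.le_mul_of_pos_right _ h1)

/-! ### Transfer to information systems -/

namespace BinarySystem

variable {U : BinarySystem.{u}} {n : ℕ}

theorem proper_iff {z : U.Problem n} {δ : Fin n → Bool} :
    U.Proper z δ ↔ δ ∈ Set.range (U.value z) :=
  exists_congr fun _ => funext_iff.symm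

theorem solves_iff {z : U.Problem n} {Γ : DecisionTree n} :
    U.Solves z Γ ↔ Γ.SolvesOn (Set.range (U.value z)) := by
  constructor
  · rintro h _ ⟨a, rfl⟩ S t hp hS
    exact h a S t hp hS
  · intro h a S t hp hS
    exact h _ ⟨a, rfl⟩ S t hp hS

theorem depths4_subset_depths5 (z : U.Problem n) : U.depths4 z ⊆ U.depths5 z :=
  fun _ ⟨Γ, h1, _, h3, h4⟩ => ⟨Γ, h1, h3, h4⟩

theorem _root_.HypothesisBound.exists_mem_depths4 {z : U.Problem n} {d : ℕ}
    (h : HypothesisBound (Set.range (U.value z)) (Set.range (U.value z)) d) :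
    ∃ e ∈ U.depths4 z, e ≤ d := by
  obtain ⟨Γ, h1, h2, h3, h4⟩ := h.exists_tree
  have hP : U.Proper z = (· ∈ Set.range (U.value z)) := funext fun δ => propext proper_iff
  exact ⟨Γ.depth, ⟨Γ, solves_iff.2 h1, h2, hP ▸ h3, rfl⟩, h4⟩

theorem hypothesisBound_dim (z : U.Problem n) :
    HypothesisBound (Set.range (U.value z)) (Set.range (U.value z)) n := by
  simpa using HypothesisBound.card_of_eqOn (Set.range (U.value z)) subset_rfl Finset.univ
    (fun _ _ _ _ i hi => absurd (Finset.mem_univ i) hi)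

theorem depths4_nonempty (z : U.Problem n) : (U.depths4 z).Nonempty := by
  obtain ⟨e, he, _⟩ := (hypothesisBound_dim z).exists_mem_depths4
  exact ⟨e, he⟩

theorem isLeast_h4Problem (z : U.Problem n) : IsLeast (U.depths4 z) (U.h4Problem z) :=
  ⟨Nat.sInf_mem (depths4_nonempty z), fun _ h => Nat.sInf_le h⟩

theorem isLeast_h5Problem (z : U.Problem n) : IsLeast (U.depths5 z) (U.h5Problem z) :=
  ⟨Nat.sInf_mem ((depths4_nonempty z).mono (depths4_subset_depths5 z)), fun _ h => Nat.sInf_le h⟩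

theorem h5Problem_le_h4Problem (z : U.Problem n) : U.h5Problem z ≤ U.h4Problem z :=
  (isLeast_h5Problem z).2 (depths4_subset_depths5 z (isLeast_h4Problem z).1)

theorem h4Problem_le {z : U.Problem n} {d : ℕ}
    (h : HypothesisBound (Set.range (U.value z)) (Set.range (U.value z)) d) :
    U.h4Problem z ≤ d := by
  obtain ⟨e, he, hed⟩ := h.exists_mem_depths4
  exact ((isLeast_h4Problem z).2 he).trans hed

theorem bddAbove_values4 (U : BinarySystem.{u}) (n : ℕ) : BddAbove (U.values4 n) := by
  refine ⟨n, ?_⟩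
  rintro _ ⟨m, _, hmn, z, rfl⟩
  exact (h4Problem_le (hypothesisBound_dim z)).trans hmn

theorem bddAbove_values5 (U : BinarySystem.{u}) (n : ℕ) : BddAbove (U.values5 n) := by
  refine ⟨n, ?_⟩
  rintro _ ⟨m, _, hmn, z, rfl⟩
  exact (h5Problem_le_h4Problem z).trans ((h4Problem_le (hypothesisBound_dim z)).trans hmn)

theorem isGreatest_h4 (hF : U.F.Nonempty) (hn : 1 ≤ n) : IsGreatest (U.values4 n) (U.h4 n) := by
  obtain ⟨f, hf⟩ := hF
  exact ⟨Nat.sSup_mem ⟨_, 1, le_rfl, hn, fun _ => ⟨f, hf⟩, rfl⟩ (bddAbove_values4 U n),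
    fun _ h => le_csSup (bddAbove_values4 U n) h⟩

theorem isGreatest_h5 (hF : U.F.Nonempty) (hn : 1 ≤ n) : IsGreatest (U.values5 n) (U.h5 n) := by
  obtain ⟨f, hf⟩ := hF
  exact ⟨Nat.sSup_mem ⟨_, 1, le_rfl, hn, fun _ => ⟨f, hf⟩, rfl⟩ (bddAbove_values5 U n),
    fun _ h => le_csSup (bddAbove_values5 U n) h⟩

theorem h4Problem_le_h4 {m : ℕ} (hm : 1 ≤ m) (hmn : m ≤ n) (z : U.Problem m) :
    U.h4Problem z ≤ U.h4 n :=
  le_csSup (bddAbove_values4 U n) ⟨m, hm, hmn, z, rfl⟩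

theorem h5Problem_le_h5 {m : ℕ} (hm : 1 ≤ m) (hmn : m ≤ n) (z : U.Problem m) :
    U.h5Problem z ≤ U.h5 n :=
  le_csSup (bddAbove_values5 U n) ⟨m, hm, hmn, z, rfl⟩

theorem h5_le_h4 (U : BinarySystem.{u}) (n : ℕ) : U.h5 n ≤ U.h4 n := by
  refine csSup_le' ?_
  rintro _ ⟨m, hm, hmn, z, rfl⟩
  exact (h5Problem_le_h4Problem z).trans (h4Problem_le_h4 hm hmn z)

theorem h4_le {d : ℕ} (h : ∀ m, m ≤ n → ∀ z : U.Problem m,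
    HypothesisBound (Set.range (U.value z)) (Set.range (U.value z)) d) : U.h4 n ≤ d := by
  refine csSup_le' ?_
  rintro _ ⟨m, _, hmn, z, rfl⟩
  exact h4Problem_le (h m hmn z)

theorem h4_le_dim (U : BinarySystem.{u}) (n : ℕ) : U.h4 n ≤ n :=
  h4_le fun _ hm z => (hypothesisBound_dim z).mono subset_rfl hm

theorem IReduced.hellyBound {r : ℕ} (hr : U.IReduced r) (z : U.Problem n) :
    HellyBound (Set.range (U.value z)) r := by
  classical
  intro J m hJ
  obtain ⟨T, hTS, hT, hTr⟩ := hr (J.image fun i => (z i, m i)) (by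
    rintro ⟨a, ha⟩
    obtain ⟨i, hi, hne⟩ := hJ _ ⟨a, rfl⟩
    exact hne (ha (z i, m i) (Finset.mem_image_of_mem _ hi)))
  -- Attributes of a problem may repeat, so one index is chosen for each equation of `T`.
  obtain ⟨K, hKJ, hK, rfl⟩ := Finset.exists_subset_injOn_image_eq_of_surjOn
    (f := fun i => (z i, m i)) (J : Set (Fin n)) T (by
      intro e he
      simpa using hTS he)
  rw [Finset.card_image_of_injOn hK] at hTr
  refine ⟨K, by exact_mod_cast hKJ, hTr, ?_⟩
  rintro _ ⟨a, rfl⟩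
  by_contra hcon
  push Not at hcon
  refine hT ⟨a, fun e he => ?_⟩
  obtain ⟨i, hi, rfl⟩ := Finset.mem_image.1 he
  exact hcon i hi

/-! ### Bounded depth from finite rank -/

/-- An information system of finite rank in which inconsistency is witnessed by boundedly many
equations admits strategies of bounded depth. -/
theorem IReduced.exists_hypothesisBound_of_isInfoOn {r : ℕ} (hr : U.IReduced r) (k : ℕ) :
    ∃ c, ∀ B : Set U.A, U.IsInfoOn k B → ∀ (n : ℕ) (z : U.Problem n),
      HypothesisBound (Set.range (U.value z)) (U.value z '' B) c := by
  induction k using Nat.strong_induction_on with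
  | _ k ih =>
    cases k with
    | zero =>
      refine ⟨0, fun B hB n z => .base _ ?_⟩
      rw [IsInfoOn] at hB
      rintro _ ⟨a, ha, rfl⟩ _ ⟨b, hb, rfl⟩
      exact funext fun i => hB _ (z i).2 a ha b hb
    | succ k =>
      choose c hc using fun m : Fin (k + 1) => ih m.1 m.2
      let C := Finset.univ.sup c
      -- The first summand pays for `r` pieces of lower rank, the second for one guess followed by a
      -- lower-rank strategy.
      refine ⟨r * (C + 1) + (C + 1), fun B hB n z => ?_⟩
      rw [IsInfoOn] at hB
      choose δ m hm using fun i => hB.2 (z i).1 (z i).2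
      have hsub : ∀ i, HypothesisBound (Set.range (U.value z))
          (U.value z '' {a | a ∈ B ∧ (z i).1 a = δ i}) C := fun i =>
        (hc (m i) _ (hm i) n z).mono subset_rfl (Finset.le_sup (Finset.mem_univ _))
      by_cases hP : (fun i => !δ i) ∈ Set.range (U.value z)
      · refine HypothesisBound.mono (.step _ hP fun i => (hsub i).mono ?_ le_rfl) subset_rfl
          (by omega : C + 1 ≤ _)
        rintro _ ⟨⟨a, ha, rfl⟩, hai⟩
        exact ⟨a, ⟨ha, by simpa [value] using hai⟩, rfl⟩
      · obtain ⟨T, _, hTr, hT⟩ := hr.hellyBound z Finset.univ (fun i => !δ i) (by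
          intro x hx
          by_contra hcon
          push Not at hcon
          exact hP (funext (fun i => hcon i (Finset.mem_univ i)) ▸ hx))
        refine (HypothesisBound.biUnion T _ (fun i _ => Set.image_subset_range _ _)
          fun i _ => hsub i).mono ?_ ((Nat.mul_le_mul_right _ hTr).trans (by omega))
        rintro _ ⟨a, ha, rfl⟩
        obtain ⟨i, hi, hai⟩ := hT _ ⟨a, rfl⟩
        exact Set.mem_biUnion hi ⟨a, ⟨ha, by simpa [value] using hai⟩, rfl⟩

theorem exists_h4_le_of_memC_of_memI (hC : U.MemC) (hI : U.MemI) : ∃ c, ∀ n, U.h4 n ≤ c := by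
  obtain ⟨_, k, _, hk⟩ := hC
  obtain ⟨_, r, _, hr⟩ := hI
  obtain ⟨c, hc⟩ := hr.exists_hypothesisBound_of_isInfoOn k
  refine ⟨c, fun n => h4_le fun m _ z => ?_⟩
  simpa using hc _ hk m z

/-! ### Independence dimension and the logarithmic upper bound -/

theorem MemD.exists_card_le (hD : U.MemD) : ∃ D, ∀ G, U.Independent G → G.card ≤ D := by
  obtain ⟨D, hD⟩ := ENat.ne_top_iff_exists.1 hD.2
  refine ⟨D, fun G hG => ?_⟩
  have : (G.card : ℕ∞) ≤ U.iDim := le_iSup₂_of_le G hG le_rfl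
  rw [← hD] at this
  exact_mod_cast this

theorem exists_independent_card_eq (h : U.iDim = ⊤) (n : ℕ) :
    ∃ G, U.Independent G ∧ G.card = n := by
  by_contra hcon
  push Not at hcon
  have : U.iDim ≤ n := by
    refine iSup₂_le fun G hG => ?_
    by_contra hlt
    rw [not_le, Nat.cast_lt] at hlt
    obtain ⟨H, hHG, hH⟩ := Finset.exists_subset_card_eq hlt.le
    refine hcon H ⟨fun f hf => hG.1 (hHG hf), fun hne δ => ?_⟩ hH
    obtain ⟨a, ha⟩ := hG.2 (hne.mono hHG) δ
    exact ⟨a, fun f hf => ha f (hHG hf)⟩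
  rw [h, top_le_iff] at this
  exact ENat.natCast_ne_top n this

/-- The number of solutions of a problem is polynomially bounded in terms of its dimension. -/
theorem card_le_of_independent_card_le {D : ℕ} (hD : ∀ G, U.Independent G → G.card ≤ D)
    (z : U.Problem n) (V : Finset (Fin n → Bool))
    (hV : (V : Set (Fin n → Bool)) = Set.range (U.value z)) : V.card ≤ (n + 1) ^ D := by
  classical
  let supp : (Fin n → Bool) → Finset (Fin n) := fun x => Finset.univ.filter fun i => x i = true
  have hsupp : Function.Injective supp := by
    intro x y hxy
    funext i
    have := Finset.ext_iff.1 hxy i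
    simp only [supp, Finset.mem_filter, Finset.mem_univ, true_and] at this
    exact Bool.eq_iff_iff.2 this
  have hdim : (V.image supp).vcDim ≤ D := by
    refine Finset.sup_le fun s hs => ?_
    rw [Finset.mem_shatterer] at hs
    have hreal : ∀ t ⊆ s, ∃ a, ∀ i ∈ s, ((z i).1 a = true ↔ i ∈ t) := by
      intro t ht
      obtain ⟨u, hu, hut⟩ := hs ht
      obtain ⟨x, hx, rfl⟩ := Finset.mem_image.1 hu
      obtain ⟨a, rfl⟩ : x ∈ Set.range (U.value z) := hV ▸ hx
      refine ⟨a, fun i hi => ?_⟩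
      rw [← hut]
      simp only [supp, Finset.mem_inter, Finset.mem_filter, Finset.mem_univ, hi, true_and]
      rfl
    -- Indices carrying the same attribute cannot be shattered, so passing to attributes keeps the
    -- cardinality.
    have hinj : Set.InjOn (fun i => (z i).1) s := by
      intro i hi j hj hij
      obtain ⟨a, ha⟩ := hreal {i} (by simpa using hi)
      have h1 := (ha i hi).2 (by simp)
      have h2 : (z j).1 a = true := (congrFun hij a).symm.trans h1
      exact (Finset.mem_singleton.1 ((ha j hj).1 h2)).symm
    rw [← Finset.card_image_of_injOn hinj]
    refine hD _ ⟨?_, fun _ δ => ?_⟩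
    · intro f hf
      obtain ⟨i, _, rfl⟩ := Finset.mem_image.1 (Finset.mem_coe.1 hf)
      exact (z i).2
    · obtain ⟨a, ha⟩ := hreal (s.filter fun i => δ (z i).1 = true) (Finset.filter_subset _ _)
      refine ⟨a, fun f hf => ?_⟩
      obtain ⟨i, hi, rfl⟩ := Finset.mem_image.1 hf
      have := ha i hi
      simp only [Finset.mem_filter, hi, true_and] at this
      exact Bool.eq_iff_iff.2 this
  calc V.card = (V.image supp).card := (Finset.card_image_of_injective _ hsupp).symm
    _ ≤ (V.image supp).shatterer.card := Finset.card_le_card_shatterer _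
    _ ≤ ∑ k ∈ Finset.Iic (V.image supp).vcDim, (Fintype.card (Fin n)).choose k :=
      Finset.card_shatterer_le_sum_vcDim
    _ ≤ ∑ k ∈ Finset.range (D + 1), n.choose k := by
      rw [Fintype.card_fin]
      refine Finset.sum_le_sum_of_subset fun k hk => ?_
      rw [Finset.mem_Iic] at hk
      exact Finset.mem_range.2 (by omega)
    _ ≤ (n + 1) ^ D := sum_choose_le_succ_pow n D

theorem h4_le_of_card_bound {D r d : ℕ} (hD : ∀ G, U.Independent G → G.card ≤ D)
    (hr : U.IReduced r) (hr2 : 2 ≤ r) (hd : (n + 1) ^ D * (r - 1) ^ d ≤ r ^ d) :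
    U.h4 n ≤ d := by
  classical
  refine h4_le fun m hm z => ?_
  have hV : ((Set.range (U.value z)).toFinset : Set (Fin m → Bool)) = Set.range (U.value z) := by
    simp
  have hcard := card_le_of_independent_card_le hD z _ hV
  have := (hr.hellyBound z).hypothesisBound hr2 d _ hV.le
    ((Nat.mul_le_mul_right _ (hcard.trans (Nat.pow_le_pow_left (by omega) D))).trans hd)
  rwa [hV] at this

theorem IReduced.mono {r s : ℕ} (h : U.IReduced r) (hrs : r ≤ s) : U.IReduced s := by
  intro S hS
  obtain ⟨T, h1, h2, h3⟩ := h S hS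
  exact ⟨T, h1, h2, h3.trans hrs⟩

/-! ### Lower bounds outside C -/

/-- A set on which the attributes do not have rank at most `d` carries a complete tree of depth
`d`. -/
theorem exists_littlestone (d : ℕ) (B : Set U.A) (hB : ∀ m ≤ d, ¬ U.IsInfoOn m B) :
    ∃ G : Finset (U.A → Bool), (G : Set (U.A → Bool)) ⊆ U.F ∧ G.card + 1 ≤ 2 ^ d ∧
      Littlestone (G : Set (U.A → Bool)) d B := by
  classical
  induction d generalizing B with
  | zero =>
    refine ⟨∅, by simp, by simp, ?_⟩
    by_contra hemp
    refine hB 0 le_rfl ?_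
    rw [IsInfoOn]
    intro f _ a ha
    exact absurd ⟨a, ha⟩ hemp
  | succ d ih =>
    have h := hB (d + 1) le_rfl
    rw [IsInfoOn, not_and] at h
    have h := h fun m => hB m.1 (by omega)
    push Not at h
    obtain ⟨f, hf, h⟩ := h
    -- Both halves under `f` avoid all ranks up to `d`; the labels number at most `1 + 2 * (2 ^ d -
    -- 1)`.
    choose G hGF hG hL using fun b : Bool =>
      ih {a | a ∈ B ∧ f a = b} fun m hm => h b ⟨m, by omega⟩
    refine ⟨insert f (G true ∪ G false), ?_, ?_, f, by simp, fun b => (hL b).mono ?_⟩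
    · intro g hg
      simp only [Finset.coe_insert, Finset.coe_union, Set.mem_insert_iff, Set.mem_union] at hg
      rcases hg with rfl | hg | hg
      exacts [hf, hGF _ hg, hGF _ hg]
    · have h1 := Finset.card_insert_le f (G true ∪ G false)
      have h2 := Finset.card_union_le (G true) (G false)
      have h3 := hG true
      have h4 := hG false
      rw [pow_succ]
      omega
    · intro g hg
      cases b
      · simp [Finset.mem_coe.1 hg]
      · simp [Finset.mem_coe.1 hg]

theorem littlestone_image (z : U.Problem n) {d : ℕ} {B : Set U.A}
    (h : Littlestone (Set.range fun i => (z i).1) d B) :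
    Littlestone (Set.range fun (i : Fin n) (x : Fin n → Bool) => x i) d (U.value z '' B) := by
  induction d generalizing B with
  | zero => exact Set.Nonempty.image _ h
  | succ d ih =>
    obtain ⟨_, ⟨i, rfl⟩, h⟩ := h
    refine ⟨_, ⟨i, rfl⟩, fun b => ?_⟩
    have := ih (h b)
    have himg : U.value z '' {a ∈ B | (z i).1 a = b} = {x ∈ U.value z '' B | x i = b} := by
      ext x
      constructor
      · rintro ⟨a, ⟨ha, hab⟩, rfl⟩
        exact ⟨⟨a, ha, rfl⟩, hab⟩
      · rintro ⟨⟨a, ha, rfl⟩, hab⟩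
        exact ⟨a, ⟨ha, hab⟩, rfl⟩
    rwa [himg] at this

theorem not_isInfoOn_univ (hU : U.IsInfinite) (hC : ¬ U.MemC) (k : ℕ) :
    ¬ U.IsInfoOn k Set.univ := by
  intro hk
  rcases Nat.eq_zero_or_pos k with rfl | hpos
  · rw [IsInfoOn] at hk
    obtain ⟨hA, hF⟩ := hU
    refine hF ((Set.finite_range fun (b : Bool) (_ : U.A) => b).subset fun f hf => ?_)
    obtain ⟨a⟩ : Nonempty U.A := inferInstance
    exact ⟨f a, funext fun b => hk f hf a trivial b trivial⟩
  · exact hC ⟨hU, k, hpos, hk⟩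

theorem exists_problem_littlestone (hU : U.IsInfinite) (hC : ¬ U.MemC) {d : ℕ} (hd : 1 ≤ d) :
    ∃ m, 1 ≤ m ∧ m + 1 ≤ 2 ^ d ∧ ∃ z : U.Problem m,
      Littlestone (Set.range fun (i : Fin m) (x : Fin m → Bool) => x i) d
        (Set.range (U.value z)) := by
  obtain ⟨G, hGF, hG, hL⟩ :=
    exists_littlestone (U := U) d Set.univ fun m _ => not_isInfoOn_univ hU hC m
  have hne : 1 ≤ G.card := by
    obtain ⟨e, rfl⟩ : ∃ e, d = e + 1 := ⟨d - 1, by omega⟩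
    obtain ⟨f, hf, _⟩ := hL
    exact Finset.card_pos.2 ⟨f, hf⟩
  let z : U.Problem G.card := fun i => ⟨G.equivFin.symm i, hGF (G.equivFin.symm i).2⟩
  refine ⟨G.card, hne, hG, z, ?_⟩
  rw [← Set.image_univ (f := U.value z)]
  refine littlestone_image z (hL.mono fun f hf => Set.mem_range.2 ⟨G.equivFin ⟨f, hf⟩, ?_⟩)
  simp [z]

theorem log_le_h4 (hU : U.IsInfinite) (hC : ¬ U.MemC) (n : ℕ) : Nat.log 2 n ≤ U.h4 n := by
  rcases Nat.eq_zero_or_pos (Nat.log 2 n) with h0 | hpos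
  · omega
  obtain ⟨m, hm, hmd, z, hz⟩ := exists_problem_littlestone hU hC hpos
  have hn : 2 ^ Nat.log 2 n ≤ n := Nat.pow_log_le_self 2 (by rintro rfl; simp at hpos)
  refine le_trans ?_ (h4Problem_le_h4 hm (by omega) z)
  obtain ⟨Γ, h1, h2, _, h4⟩ := (isLeast_h4Problem z).1
  rw [← h4]
  exact (solves_iff.1 h1).littlestone_le_depth h2 hz

theorem two_pow_log_le (hU : U.IsInfinite) (hC : ¬ U.MemC) (n : ℕ) :
    2 ^ Nat.log 2 n ≤ (Nat.log 2 n + 1) ^ U.h5 n := by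
  classical
  rcases Nat.eq_zero_or_pos (Nat.log 2 n) with h0 | hpos
  · simp [h0]
  obtain ⟨m, hm, hmd, z, hz⟩ := exists_problem_littlestone hU hC hpos
  have hn : 2 ^ Nat.log 2 n ≤ n := Nat.pow_log_le_self 2 (by rintro rfl; simp at hpos)
  refine le_trans ?_ (Nat.pow_le_pow_right (by omega) (h5Problem_le_h5 hm (by omega) z))
  obtain ⟨Γ, h1, _, h4⟩ := (isLeast_h5Problem z).1
  obtain ⟨L, hLV, hL, hLJ⟩ := hz.exists_finset
  rw [← h4, ← hL]
  refine ((solves_iff.1 h1).mono hLV).card_le_pow_depth hpos fun δ => ?_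
  have hinj : Function.Injective fun (i : Fin m) (x : Fin m → Bool) => x i := by
    intro i j hij
    simpa using congrFun hij fun k => decide (k = j)
  -- `δ` is transported to coordinate functions; the default `false` is never used, because `J`
  -- contains only those.
  obtain ⟨J, hJP, hJ, x₀, hx₀⟩ := hLJ fun f => if h : ∃ i, (fun x => x i) = f then δ h.choose
    else false
  refine ⟨J.preimage (fun (i : Fin m) (x : Fin m → Bool) => x i) hinj.injOn, ?_, x₀, ?_⟩
  · rw [Finset.card_preimage]
    exact (Finset.card_filter_le _ _).trans hJ
  · intro x hx hne
    obtain ⟨f, hf, hfx⟩ := hx₀ x hx hne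
    obtain ⟨i, rfl⟩ := hJP hf
    refine ⟨i, Finset.mem_preimage.2 hf, ?_⟩
    have hex : ∃ j : Fin m, (fun x : Fin m → Bool => x j) = fun x => x i := ⟨i, rfl⟩
    rw [dif_pos hex, hinj hex.choose_spec] at hfx
    exact hfx

/-! ### Linear lower bounds outside D and outside I -/

theorem le_h5_of_not_memD (hU : U.IsInfinite) (hD : ¬ U.MemD) (hn : 1 ≤ n) : n ≤ U.h5 n := by
  have htop : U.iDim = ⊤ := by
    by_contra h
    exact hD ⟨hU, h⟩
  obtain ⟨G, hG, rfl⟩ := exists_independent_card_eq htop n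
  let z : U.Problem G.card := fun i => ⟨G.equivFin.symm i, hG.1 (G.equivFin.symm i).2⟩
  refine le_trans ?_ (h5Problem_le_h5 hn le_rfl z)
  obtain ⟨Γ, h1, _, h4⟩ := (isLeast_h5Problem z).1
  rw [← h4]
  have := (solves_iff.1 h1).card_le_depth_of_cube Finset.univ (fun _ => false) (by
    classical
    intro x _
    obtain ⟨a, ha⟩ := hG.2 (Finset.card_pos.1 hn) fun f =>
      if h : f ∈ G then x (G.equivFin ⟨f, h⟩) else false
    refine ⟨a, funext fun i => ?_⟩
    have := ha _ (G.equivFin.symm i).2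
    simpa [z, value] using this)
  simpa using this

theorem le_h5_of_not_iReduced {r : ℕ} (hr : 1 ≤ r) (h : ¬ U.IReduced r) :
    ∃ n, r < n ∧ n ≤ U.h5 n + 1 := by
  classical
  unfold IReduced at h
  push Not at h
  obtain ⟨S, hS, hr'⟩ := h
  obtain ⟨T, hTS, hT⟩ := exists_minimal_le_of_wellFoundedLT (fun T => ¬ U.Consistent T) S hS
  refine ⟨T.card, hr' T hTS hT.1, ?_⟩
  let z : U.Problem T.card := fun i => (T.equivFin.symm i).1.1
  let y : Fin T.card → Bool := fun i => (T.equivFin.symm i).1.2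
  have hpos : 1 ≤ T.card := by
    have := hr' T hTS hT.1
    omega
  refine le_trans ?_ (Nat.succ_le_succ (h5Problem_le_h5 hpos le_rfl z))
  obtain ⟨Γ, h1, h3, h4⟩ := (isLeast_h5Problem z).1
  have hy : ¬ U.Proper z y := by
    rintro ⟨a, ha⟩
    refine hT.1 ⟨a, fun e he => ?_⟩
    simpa [z, y] using ha (T.equivFin ⟨e, he⟩)
  have := (solves_iff.1 h1).card_le_depth_of_star h3 hy Finset.univ (by
    intro i _
    let e := T.equivFin.symm i
    -- By minimality, dropping one equation gives a solution; as `y` is improper, it must violate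
    -- exactly the dropped one.
    have hcons : U.Consistent (T.erase e.1) := by
      by_contra hcon
      exact Finset.notMem_erase e.1 T (hT.2 hcon (Finset.erase_subset _ _) e.2)
    obtain ⟨a, ha⟩ := hcons
    have hother : ∀ j, j ≠ i → U.value z a j = y j := by
      intro j hj
      refine ha _ (Finset.mem_erase.2 ⟨?_, (T.equivFin.symm j).2⟩)
      exact fun h => hj (T.equivFin.symm.injective (Subtype.ext h))
    refine ⟨a, funext fun j => ?_⟩
    by_cases hj : j = i
    · subst hj
      rw [Function.update_self]
      refine Bool.eq_not.2 fun hja => hy ⟨a, fun k => ?_⟩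
      by_cases hk : k = j
      · exact hk ▸ hja
      · exact hother k hk
    · rw [Function.update_of_ne hj, hother j hj])
  rw [Finset.card_univ, Fintype.card_fin] at this
  omega

end BinarySystem

/-! ### Asymptotic forms -/

namespace BinarySystem

variable {U : BinarySystem.{u}}

theorem h4_isBigO_log (hD : U.MemD) (hI : U.MemI) :
    (fun n : ℕ => (U.h4 n : ℝ)) =O[atTop] (fun n : ℕ => Real.log (n : ℝ)) := by
  obtain ⟨D, hD⟩ := hD.exists_card_le
  obtain ⟨_, r, _, hr⟩ := hI
  -- Enlarging the Helly number makes it at least 2, as the balanced guess requires.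
  replace hr := hr.mono (Nat.le_add_right r 2)
  set s := r + 1
  have hs : (0 : ℝ) < s := by positivity
  set q : ℝ := (s + 1) / s with hq
  have hq1 : 1 < q := by
    rw [hq, lt_div_iff₀ hs]
    linarith
  have hlogq : 0 < Real.log q := Real.log_pos hq1
  have hbound : ∀ n : ℕ, (U.h4 n : ℝ) ≤ D * Real.log (n + 1) / Real.log q + 1 := by
    intro n
    have hnn : 0 ≤ D * Real.log ((n : ℝ) + 1) / Real.log q :=
      div_nonneg (mul_nonneg (Nat.cast_nonneg _) (Real.log_nonneg (by simp))) hlogq.le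
    refine le_trans ?_ (Nat.ceil_lt_add_one hnn).le
    refine Nat.cast_le.2 (h4_le_of_card_bound hD hr (by omega) ?_)
    set d := ⌈D * Real.log ((n : ℝ) + 1) / Real.log q⌉₊
    have hd : D * Real.log ((n : ℝ) + 1) ≤ d * Real.log q :=
      (div_le_iff₀ hlogq).1 (Nat.le_ceil _)
    rw [← Real.log_pow, ← Real.log_pow] at hd
    have hd' : ((n : ℝ) + 1) ^ D ≤ q ^ d :=
      (Real.log_le_log_iff (by positivity) (by positivity)).1 hd
    rw [hq, div_pow, le_div_iff₀ (by positivity)] at hd'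
    rw [show r + 2 - 1 = s by omega, show r + 2 = s + 1 by omega]
    exact_mod_cast hd'
  have hlog1 : ∀ᶠ n : ℕ in atTop, 1 ≤ Real.log (n : ℝ) :=
    (Real.tendsto_log_atTop.comp tendsto_natCast_atTop_atTop).eventually_ge_atTop 1
  refine IsBigO.of_bound (D * 2 / Real.log q + 1) ?_
  filter_upwards [hlog1, eventually_ge_atTop 2] with n h1 h2
  have h2' : (2 : ℝ) ≤ n := by exact_mod_cast h2
  rw [Real.norm_of_nonneg (Nat.cast_nonneg _), Real.norm_of_nonneg (by linarith)]
  have h3 : Real.log ((n : ℝ) + 1) ≤ 2 * Real.log n := by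
    have : Real.log ((n : ℝ) ^ 2) = 2 * Real.log n := by simp [Real.log_pow]
    rw [← this]
    exact Real.log_le_log (by positivity) (by nlinarith)
  calc (U.h4 n : ℝ) ≤ D * Real.log (n + 1) / Real.log q + 1 := hbound n
    _ ≤ D * (2 * Real.log n) / Real.log q + 1 * Real.log n := by
      gcongr
      linarith
    _ = (D * 2 / Real.log q + 1) * Real.log n := by ring

theorem _root_.Real.log_le_two_mul_natLog_mul_log_two {n : ℕ} (hn : 2 ≤ n) :
    Real.log n ≤ 2 * (Nat.log 2 n * Real.log 2) := by
  have h1 : 1 ≤ Nat.log 2 n := (Nat.le_log_iff_pow_le (by norm_num) (by omega)).2 (by simpa using hn)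
  have h2 : n ≤ 2 ^ (Nat.log 2 n * 2) :=
    (Nat.lt_pow_succ_log_self (by norm_num) n).le.trans
      (Nat.pow_le_pow_right (by norm_num) (by omega))
  have h3 : (n : ℝ) ≤ 2 ^ (Nat.log 2 n * 2) := by exact_mod_cast h2
  have h4 := Real.log_le_log (by positivity) h3
  rw [Real.log_pow] at h4
  push_cast at h4
  linarith

theorem log_isBigO_h4 (hU : U.IsInfinite) (hC : ¬ U.MemC) :
    (fun n : ℕ => Real.log (n : ℝ)) =O[atTop] (fun n : ℕ => (U.h4 n : ℝ)) := by
  refine IsBigO.of_bound (2 * Real.log 2) ?_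
  filter_upwards [eventually_ge_atTop 2] with n hn
  have h1 : (Nat.log 2 n : ℝ) ≤ U.h4 n := Nat.cast_le.2 (log_le_h4 hU hC n)
  have h2 := Real.log_le_two_mul_natLog_mul_log_two hn
  have h3 : 0 < Real.log 2 := Real.log_pos (by norm_num)
  rw [Real.norm_of_nonneg (Nat.cast_nonneg _),
    Real.norm_of_nonneg (Real.log_nonneg (by exact_mod_cast (by omega : 1 ≤ n)))]
  nlinarith

theorem log_div_log_log_isBigO_h5 (hU : U.IsInfinite) (hC : ¬ U.MemC) :
    (fun n : ℕ => Real.log (n : ℝ) / Real.log (Real.log (n : ℝ)))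
      =O[atTop] (fun n : ℕ => (U.h5 n : ℝ)) := by
  have hlog : ∀ᶠ n : ℕ in atTop, 4 ≤ Real.log (n : ℝ) :=
    (Real.tendsto_log_atTop.comp tendsto_natCast_atTop_atTop).eventually_ge_atTop 4
  refine IsBigO.of_bound 4 ?_
  filter_upwards [hlog, eventually_ge_atTop 2] with n hL hn
  have hloglog : 0 < Real.log (Real.log (n : ℝ)) := Real.log_pos (by linarith)
  rw [Real.norm_of_nonneg (Nat.cast_nonneg _), Real.norm_of_nonneg (by positivity),
    div_le_iff₀ hloglog]
  have h1 := Real.log_le_two_mul_natLog_mul_log_two hn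
  have h2 : ((2 : ℝ) ^ Nat.log 2 n) ≤ ((Nat.log 2 n : ℝ) + 1) ^ U.h5 n := by
    exact_mod_cast two_pow_log_le hU hC n
  have h3 := Real.log_le_log (by positivity) h2
  rw [Real.log_pow, Real.log_pow] at h3
  have h4 : Nat.log 2 n * Real.log 2 ≤ Real.log (n : ℝ) := by
    rw [← Real.log_pow]
    refine Real.log_le_log (by positivity) ?_
    exact_mod_cast Nat.pow_log_le_self 2 (by omega)
  -- As `Nat.log 2 n ≤ 2 * log n` and `log n ≥ 4`, squaring absorbs base and summand; it costs a
  -- factor 2, and rounding in `Nat.log` the other 2 of the constant 4.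
  have h5 : (Nat.log 2 n : ℝ) + 1 ≤ Real.log (n : ℝ) ^ 2 := by
    have h6 : (1 : ℝ) / 2 ≤ Real.log 2 := by linarith [Real.log_two_gt_d9]
    have h7 : (0 : ℝ) ≤ Nat.log 2 n := Nat.cast_nonneg _
    nlinarith
  have h8 : Real.log ((Nat.log 2 n : ℝ) + 1) ≤ 2 * Real.log (Real.log (n : ℝ)) := by
    have := Real.log_le_log (by positivity) h5
    rwa [Real.log_pow, Nat.cast_ofNat] at this
  have h9 := mul_le_mul_of_nonneg_left h8 (Nat.cast_nonneg (α := ℝ) (U.h5 n))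
  linarith

theorem infinite_setOf_sub_one_le_h5 (hU : U.IsInfinite) (hI : ¬ U.MemI) :
    {n : ℕ | 1 ≤ n ∧ (n : ℝ) - 1 ≤ (U.h5 n : ℝ)}.Infinite := by
  refine Set.infinite_of_not_bddAbove ?_
  rintro ⟨b, hb⟩
  obtain ⟨n, hn, hle⟩ := le_h5_of_not_iReduced (U := U) (r := b + 1) (by omega)
    fun h => hI ⟨hU, b + 1, by omega, h⟩
  have hle' : (n : ℝ) ≤ U.h5 n + 1 := by exact_mod_cast hle
  have := hb (show n ∈ _ from ⟨by omega, by linarith⟩)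
  omega

end BinarySystem

theorem theorem4 (U : BinarySystem.{u}) (hU : U.IsInfinite) :
    (∀ n : ℕ, 1 ≤ n → ∀ z : U.Problem n,
      IsLeast (U.depths4 z) (U.h4Problem z) ∧ IsLeast (U.depths5 z) (U.h5Problem z)) ∧
    (∀ n : ℕ, 1 ≤ n →
      IsGreatest (U.values4 n) (U.h4 n) ∧ IsGreatest (U.values5 n) (U.h5 n)) ∧
    (U.MemC ∧ U.MemI →
      (fun n : ℕ => (U.h4 n : ℝ)) =O[atTop] (fun _ : ℕ => (1 : ℝ)) ∧
      (fun n : ℕ => (U.h5 n : ℝ)) =O[atTop] (fun _ : ℕ => (1 : ℝ))) ∧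
    ((U.MemD ∧ ¬ U.MemC) ∧ U.MemI →
      (fun n : ℕ => (U.h4 n : ℝ)) =Θ[atTop] (fun n : ℕ => Real.log (n : ℝ)) ∧
      (fun n : ℕ => Real.log (n : ℝ) / Real.log (Real.log (n : ℝ)))
        =O[atTop] (fun n : ℕ => (U.h5 n : ℝ)) ∧
      (fun n : ℕ => (U.h5 n : ℝ)) =O[atTop] (fun n : ℕ => Real.log (n : ℝ))) ∧
    (U.MemD ∧ ¬ U.MemI →
      ({n : ℕ | 1 ≤ n ∧ (n : ℝ) - 1 ≤ (U.h4 n : ℝ)}.Infinite ∧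
        ∀ n : ℕ, 1 ≤ n → U.h4 n ≤ n) ∧
      ({n : ℕ | 1 ≤ n ∧ (n : ℝ) - 1 ≤ (U.h5 n : ℝ)}.Infinite ∧
        ∀ n : ℕ, 1 ≤ n → U.h5 n ≤ n)) ∧
    (¬ U.MemD →
      ∀ n : ℕ, 1 ≤ n → U.h4 n = n ∧ U.h5 n = n) := by
  have h54 : ∀ n, U.h5 n ≤ U.h4 n := U.h5_le_h4
  have h4n : ∀ n, U.h4 n ≤ n := U.h4_le_dim
  have h54O : (fun n : ℕ => (U.h5 n : ℝ)) =O[atTop] (fun n : ℕ => (U.h4 n : ℝ)) :=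
    IsBigO.of_norm_le fun n => by
      rw [Real.norm_of_nonneg (Nat.cast_nonneg _)]
      exact Nat.cast_le.2 (h54 n)
  refine ⟨fun n _ z => ⟨BinarySystem.isLeast_h4Problem z, BinarySystem.isLeast_h5Problem z⟩,
    fun n hn => ⟨BinarySystem.isGreatest_h4 hU.2.nonempty hn,
      BinarySystem.isGreatest_h5 hU.2.nonempty hn⟩, ?_, ?_, ?_, ?_⟩
  · rintro ⟨hC, hI⟩
    obtain ⟨c, hc⟩ := BinarySystem.exists_h4_le_of_memC_of_memI hC hI
    have h4 : (fun n : ℕ => (U.h4 n : ℝ)) =O[atTop] (fun _ : ℕ => (1 : ℝ)) := by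
      refine IsBigO.of_bound c (Eventually.of_forall fun n => ?_)
      rw [Real.norm_of_nonneg (Nat.cast_nonneg _), norm_one, mul_one]
      exact Nat.cast_le.2 (hc n)
    exact ⟨h4, h54O.trans h4⟩
  · rintro ⟨⟨hD, hC⟩, hI⟩
    have h4 := BinarySystem.h4_isBigO_log hD hI
    exact ⟨⟨h4, BinarySystem.log_isBigO_h4 hU hC⟩,
      BinarySystem.log_div_log_log_isBigO_h5 hU hC, h54O.trans h4⟩
  · rintro ⟨_, hI⟩
    have h5 := BinarySystem.infinite_setOf_sub_one_le_h5 hU hI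
    refine ⟨⟨h5.mono fun n hn => ⟨hn.1, hn.2.trans (Nat.cast_le.2 (h54 n))⟩, fun n _ => h4n n⟩,
      h5, fun n _ => (h54 n).trans (h4n n)⟩
  · intro hD n hn
    have h5 := BinarySystem.le_h5_of_not_memD hU hD hn
    exact ⟨(h4n n).antisymm (h5.trans (h54 n)), ((h54 n).trans (h4n n)).antisymm h5⟩
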